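/- Let $L,R\ge 0$ be integers and put $l'=\lfloor L/2\rfloor$, $l=L-l'$, $r'=\lfloor R/2\rfloor$, $r=R-r'$. A hybrid-variable (HV) discrete differential operator with stencil $(L,R)$ is given by real coefficients $\alpha_k$ ($-l\le k\le r-1$) and $\beta_k$ ($-l'\le k\le r'$). Applied on a uniform grid of size $h$ to a function $u$ at a node $x$ it gives $$[\mathcal D u](x)=\frac1h\sum_{k=-l}^{r-1}\alpha_k\,\frac1h\int_{x+kh}^{x+(k+1)h}u(y)\,dy+\frac1h\sum_{k=-l'}^{r'}\beta_k\,u(x+kh).$$ It is optimally accurate if it is of order $p=L+R$, that is, if for some constant $c\ne0$, for all smooth $u$ and all $x$, $[\mathcal D u](x)=u'(x)+c\,u^{(p+1)}(x)\,h^p+O(h^{p+1})$ as $h\to0^+$. Write $G(\theta)=\sum_{k=-l}^{r-1}\alpha_ke^{ik\theta}$, $H(\theta)=\sum_{k=-l'}^{r'}\beta_ke^{ik\theta}$ and $F(\theta)=(e^{i\theta}-1)G(\theta)$. Theorem. Let $\mathcal D$ be an optimally accurate HV discrete differential operator with stencil $(L,R)$. (1) If $\operatorname{Re}H(\theta)>0$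 for all $0<\theta\le\pi$, then $$L-R<\min\bigl(2R+7,\;9+\sqrt{21R+49}\bigr).$$ (2) Consequently, if $L-R\ge\min\bigl(2R+7,\,9+\sqrt{21R+49}\bigr)$, the HV method is unstable, in both of the following senses. (a) It is not true that for every number $N\ge1$ of cells and every cell size $h>0$ the semi-discretization of $u_t+u_x=0$ on a periodic grid, $$\overline u_{j+1/2}'=-\frac{u_{j+1}-u_j}{h},\qquad u_j'=-\frac1h\sum_{k=-l}^{r-1}\alpha_k\overline u_{j+k+1/2}-\frac1h\sum_{k=-l'}^{r'}\beta_ku_{j+k}\qquad(j\in\mathbb Z/N\mathbb Z),$$ has only eigenvalues with negative real part, except at most a simple one at zero. (b) The set of the roots $\lambda\in\mathbb C$ of $\lambda^2-H(\theta)\lambda-F(\theta)=0$, $0<\theta<2\pi$, is not contained in the open right half-plane. -/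

import Mathlib

open scoped ContDiff Topology

namespace HV

noncomputable section

/-- Number `l'` of nodes on the left (upwind side) in the stencil `(L, R)`; the same function
gives the number `r'` of nodes on the right when applied to `R`. -/
def numNodes (L : ℕ) : ℕ := L / 2

/-- Number `l` of cells on the left in the stencil `(L, R)`; the same function gives the number
`r` of cells on the right when applied to `R`. -/
def numCells (L : ℕ) : ℕ := L - numNodes L

/-- Offsets `-l, …, r - 1` of the cells of the stencil `(L, R)`; offset `k` at the node `j`
stands for the cell `[x_{j+k}, x_{j+k+1}]`. -/
def cells (L R : ℕ) : Finset ℤ := Finset.Ico (-(numCells L : ℤ)) (numCells R : ℤ)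

/-- Offsets `-l', …, r'` of the nodes of the stencil `(L, R)`. -/
def nodes (L R : ℕ) : Finset ℤ := Finset.Icc (-(numNodes L : ℤ)) (numNodes R : ℤ)

/-- A hybrid-variable discrete differential operator with stencil `(L, R)`, given by its real
coefficients. Only the values of `α` on `cells L R` and of `β` on `nodes L R` are ever used. -/
structure DDO (L R : ℕ) where
  /-- coefficients of the cell averages -/
  α : ℤ → ℝ
  /-- coefficients of the nodal values -/
  β : ℤ → ℝ

/-- The average of `u` over the cell `[a, a + h]`. -/
def cellAverage (u : ℝ → ℝ) (h a : ℝ) : ℝ := (1 / h) * ∫ y in a..(a + h), u y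

namespace DDO

variable {L R : ℕ}

/-- The operator applied, at the node `x` of a uniform grid of size `h`, to the exact cell
averages and nodal values of the function `u`. -/
def apply (D : DDO L R) (u : ℝ → ℝ) (h x : ℝ) : ℝ :=
  (1 / h) * ∑ k ∈ cells L R, D.α k * cellAverage u h (x + k * h)
    + (1 / h) * ∑ k ∈ nodes L R, D.β k * u (x + k * h)

/-- `D` is accurate of order `p`: for some constant `c ≠ 0` and every smooth function `u`,
`D u (x) = u'(x) + c u⁽ᵖ⁺¹⁾(x) hᵖ + O(hᵖ⁺¹)` as `h → 0⁺`. -/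
def HasOrder (D : DDO L R) (p : ℕ) : Prop :=
  ∃ c : ℝ, c ≠ 0 ∧ ∀ u : ℝ → ℝ, ContDiff ℝ ∞ u → ∀ x : ℝ,
    (fun h : ℝ => D.apply u h x - (deriv u x + c * iteratedDeriv (p + 1) u x * h ^ p))
      =O[𝓝[>] (0 : ℝ)] (fun h : ℝ => h ^ (p + 1))

/-- `D` has the optimal order of accuracy for its stencil, `l + r + l' + r' = L + R`. -/
def IsOptimal (D : DDO L R) : Prop := D.HasOrder (L + R)

/-- `G(θ) = ∑ α_k e^{ikθ}`. -/
def G (D : DDO L R) (θ : ℝ) : ℂ :=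
  ∑ k ∈ cells L R, (D.α k : ℂ) * Complex.exp (Complex.I * k * θ)

/-- `H(θ) = ∑ β_k e^{ikθ}`. -/
def H (D : DDO L R) (θ : ℝ) : ℂ :=
  ∑ k ∈ nodes L R, (D.β k : ℂ) * Complex.exp (Complex.I * k * θ)

/-- `F(θ) = (e^{iθ} - 1) G(θ)`. -/
def F (D : DDO L R) (θ : ℝ) : ℂ := (Complex.exp (Complex.I * θ) - 1) * D.G θ

/-- The set `𝒮'` of all roots `z` of `z² - H(θ) z - F(θ)` with `0 < θ < 2π`. -/
def rootSet (D : DDO L R) : Set ℂ :=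
  {z | ∃ θ : ℝ, 0 < θ ∧ θ < 2 * Real.pi ∧ z ^ 2 - D.H θ * z - D.F θ = 0}

/-- The right-hand side of the semi-discretization of `u_t + u_x = 0` on a periodic grid with `N`
cells of size `h`, as a linear operator on the vectors (cell averages, nodal values):
`ū_{j+1/2}' = -(u_{j+1} - u_j) / h` and `u_j' = -[D u]_j`.
Entry `j` of the first component is `ū_{j+1/2}`, entry `j` of the second one is `u_j`. -/
def semiDiscrete (D : DDO L R) (N : ℕ) (h : ℝ) :
    Module.End ℂ ((ZMod N → ℂ) × (ZMod N → ℂ)) where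
  toFun w :=
    (fun j => -((1 / (h : ℂ)) * (w.2 (j + 1) - w.2 j)),
     fun j => -((1 / (h : ℂ)) * ∑ k ∈ cells L R, (D.α k : ℂ) * w.1 (j + (k : ZMod N))
        + (1 / (h : ℂ)) * ∑ k ∈ nodes L R, (D.β k : ℂ) * w.2 (j + (k : ZMod N))))
  map_add' v w := by
    ext j
    · simp only [Prod.fst_add, Prod.snd_add, Pi.add_apply]
      ring
    · simp only [Prod.fst_add, Prod.snd_add, Pi.add_apply, mul_add, Finset.sum_add_distrib]
      ring
  map_smul' a w := by
    ext j
    · simp only [Prod.smul_fst, Prod.smul_snd, Pi.smul_apply, smul_eq_mul, RingHom.id_apply]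
      ring
    · simp only [Prod.smul_fst, Prod.smul_snd, Pi.smul_apply, smul_eq_mul, RingHom.id_apply,
        mul_left_comm _ a, ← Finset.mul_sum]
      ring

/-- The semi-discrete system on `N` cells of size `h` is stable: all its eigenvalues have
negative real part, except at most an (algebraically) simple one at zero. -/
def IsStableOn (D : DDO L R) (N : ℕ) (h : ℝ) : Prop :=
  (∀ μ : ℂ, (D.semiDiscrete N h).HasEigenvalue μ → μ.re < 0 ∨ μ = 0) ∧
    Module.finrank ℂ ((D.semiDiscrete N h).maxGenEigenspace 0) ≤ 1

/-- The semi-discretized method is stable: its system is stable for every number of cells and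
every cell size (hence every domain size). -/
def IsStable (D : DDO L R) : Prop :=
  ∀ N : ℕ, 0 < N → ∀ h : ℝ, 0 < h → D.IsStableOn N h

end DDO

end

end HV

/-! For strong upwinding, the low Fourier coefficients of `Re H` force it to be negative somewhere.
Averaging `Re H(θ) (1 - cos θ)` over the `N`-th roots of unity, with `N > L + R + 1` so that nothing
aliases, isolates `β₀ - (β₋₁ + β₁)/2 = -defect`. The weight is nonnegative and vanishes at `θ = 0`,
so a positive defect makes `Re H` negative at some `2πm/N` with `0 < m < N` (`exists_re_H_neg`).

Optimality determines these coefficients: the operator is exact on polynomials of degree at most `L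
+ R`, and testing it on derivatives of products of nodal polynomials isolates one `β_k` at a time
(`beta_mul_nodal`). The results are harmonic numbers and ratios of factorials. Bounding harmonic
differences by logarithms, and those by rational functions, turns `defect_pos` into polynomial
inequalities.

Finally, the roots of `λ² - Hλ - F` sum to `H`, so `Re H < 0` gives a root in the left half-plane.
At `θ = 2πm/N` the corresponding Fourier mode is an unstable eigenvector on `N` cells. -/

namespace HV

/-! ### Harmonic numbers and elementary inequalities. -/

/-- The `n`-th harmonic number as a real number. -/
noncomputable def harm (n : ℕ) : ℝ := ∑ i ∈ Finset.range n, 1 / ((i : ℝ) + 1)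

lemma harm_succ (n : ℕ) : harm (n + 1) = harm n + 1 / ((n : ℝ) + 1) :=
  Finset.sum_range_succ _ _

lemma harm_le_linear (n : ℕ) : harm n ≤ 1 + n / 3 := by
  induction n with
  | zero => simp [harm]
  | succ n ih =>
    rcases Nat.lt_or_ge n 2 with h | h
    · interval_cases n <;> norm_num [harm, Finset.sum_range_succ]
    · have h' : (3 : ℝ) ≤ n + 1 := by
        have : (2 : ℝ) ≤ n := by exact_mod_cast h
        linarith
      have := one_div_le_one_div_of_le (by norm_num) h'
      rw [harm_succ]
      push_cast
      linarith

/-- Each increment satisfies `1/(n+1) ≤ log((2n+3)/(2n+1))`, which is `log(1+x) ≥ 2x/(x+2)` at `x =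
2/(2n+1)`; the logarithms telescope. -/
lemma harm_sub_le_log {m n : ℕ} (h : m ≤ n) :
    harm n - harm m ≤ Real.log ((2 * n + 1) / (2 * m + 1)) := by
  induction n, h using Nat.le_induction with
  | base =>
    rw [div_self (by positivity)]
    simp
  | succ n _ ih =>
    have h1 := Real.le_log_one_add_of_nonneg (x := 2 / (2 * (n : ℝ) + 1)) (by positivity)
    have e1 : 2 * (2 / (2 * (n : ℝ) + 1)) / (2 / (2 * (n : ℝ) + 1) + 2) = 1 / ((n : ℝ) + 1) := by
      field_simp
      ring
    have e2 : (2 * ((n + 1 : ℕ) : ℝ) + 1) / (2 * m + 1)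
        = ((2 * n + 1) / (2 * m + 1)) * (1 + 2 / (2 * (n : ℝ) + 1)) := by
      push_cast
      field_simp
      ring
    rw [e1] at h1
    rw [harm_succ, e2, Real.log_mul (by positivity) (by positivity)]
    linarith

/-- This is `t ≤ sinh t` at `t = log y`. -/
lemma two_mul_log_le_sub_inv {y : ℝ} (hy : 1 ≤ y) : 2 * Real.log y ≤ y - y⁻¹ := by
  have := Real.self_le_sinh_iff.2 (Real.log_nonneg hy)
  rw [Real.sinh_log (by linarith)] at this
  linarith

/-- A positivity certificate: subtract `2DY³` and `D²Y²/2` times the nonnegative `D² - 15Y - 15D`;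
after shifting `Y` and `D` to their lower bounds, only positive coefficients remain. In the
application `Y = R + 1` and `D = L - R`. -/
lemma poly_pos_of_sq {D Y : ℝ} (hY : 10 ≤ Y) (hD : 24 ≤ D) (h : 15 * Y + 15 * D ≤ D ^ 2) :
    0 < ((Y + D) ^ 4 - 4 * (Y + D) ^ 2 - (Y ^ 2 - 1) ^ 2) * Y * (Y - 1)
      - 2 * ((Y + D) ^ 2 - Y ^ 2) * (Y + 1) ^ 2 * ((Y + D) + 2) * (Y - 1)
      - 2 * (Y + 1) * (Y + D) * ((Y + D) + 2) * Y := by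
  obtain ⟨v, rfl⟩ : ∃ v, Y = 10 + v := ⟨Y - 10, by ring⟩
  have hv : 0 ≤ v := by linarith
  obtain ⟨w, rfl⟩ : ∃ w, D = 24 + w := ⟨D - 24, by ring⟩
  have hw : 0 ≤ w := by linarith
  have h1 : 0 ≤ (24 + w) * (10 + v) ^ 3 * ((24 + w) ^ 2 - (15 * (10 + v) + 15 * (24 + w))) :=
    mul_nonneg (by positivity) (by linarith)
  have h2 : 0 ≤ (24 + w) ^ 2 * (10 + v) ^ 2 * ((24 + w) ^ 2 - (15 * (10 + v) + 15 * (24 + w))) :=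
    mul_nonneg (by positivity) (by linarith)
  have key : 0 < (((10 + v) + (24 + w)) ^ 4 - 4 * ((10 + v) + (24 + w)) ^ 2
        - ((10 + v) ^ 2 - 1) ^ 2) * (10 + v) * ((10 + v) - 1)
      - 2 * (((10 + v) + (24 + w)) ^ 2 - (10 + v) ^ 2) * ((10 + v) + 1) ^ 2
        * (((10 + v) + (24 + w)) + 2) * ((10 + v) - 1)
      - 2 * ((10 + v) + 1) * ((10 + v) + (24 + w)) * (((10 + v) + (24 + w)) + 2) * (10 + v)
      - 2 * ((24 + w) * (10 + v) ^ 3 * ((24 + w) ^ 2 - (15 * (10 + v) + 15 * (24 + w))))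
      - 1 / 2 * ((24 + w) ^ 2 * (10 + v) ^ 2
        * ((24 + w) ^ 2 - (15 * (10 + v) + 15 * (24 + w)))) := by
    ring_nf
    positivity
  linarith

lemma poly_pos_of_linear {X Y : ℝ} (hY : 3 ≤ Y) (h : 3 * Y + 5 ≤ X) :
    0 < (X ^ 4 - 4 * X ^ 2 - (Y ^ 2 - 1) ^ 2) * Y * (Y - 1)
      - 2 * (X ^ 2 - Y ^ 2) * (Y + 1) ^ 2 * (X + 2) * (Y - 1)
      - 2 * (Y + 1) * X * (X + 2) * Y := by
  obtain ⟨v, rfl⟩ : ∃ v, Y = 3 + v := ⟨Y - 3, by ring⟩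
  have hv : 0 ≤ v := by linarith
  obtain ⟨w, rfl⟩ : ∃ w, X = 3 * (3 + v) + 5 + w := ⟨X - (3 * (3 + v) + 5), by ring⟩
  have hw : 0 ≤ w := by linarith
  ring_nf
  positivity

/-- With `X = L + 1` and `Y = R + 1`, the left side will dominate the harmonic part of the defect
and the right side will bound its rational part from below. The hypothesis is the numerator of their
difference. -/
lemma rational_lt {X Y : ℝ} (hY : 1 < Y) (hX : 0 < X)
    (h : 0 < (X ^ 4 - 4 * X ^ 2 - (Y ^ 2 - 1) ^ 2) * Y * (Y - 1)
      - 2 * (X ^ 2 - Y ^ 2) * (Y + 1) ^ 2 * (X + 2) * (Y - 1)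
      - 2 * (Y + 1) * X * (X + 2) * Y) :
    2 * (X / Y - (X / Y)⁻¹) + 2 / (Y ^ 2 - 1)
      < X * (X - 2) / (Y + 1) ^ 2 - (Y - 1) ^ 2 / (X * (X + 2)) := by
  have h1 : 0 < Y - 1 := by linarith
  have h2 : Y ^ 2 - 1 ≠ 0 := by nlinarith
  have h3 : (Y ^ 2 - 1) = (Y - 1) * (Y + 1) := by ring
  rw [← sub_pos]
  have e : X * (X - 2) / (Y + 1) ^ 2 - (Y - 1) ^ 2 / (X * (X + 2))
      - (2 * (X / Y - (X / Y)⁻¹) + 2 / (Y ^ 2 - 1))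
      = ((X ^ 4 - 4 * X ^ 2 - (Y ^ 2 - 1) ^ 2) * Y * (Y - 1)
      - 2 * (X ^ 2 - Y ^ 2) * (Y + 1) ^ 2 * (X + 2) * (Y - 1)
      - 2 * (Y + 1) * X * (X + 2) * Y) / ((Y + 1) ^ 2 * X * (X + 2) * Y * (Y - 1)) := by
    rw [h3]
    have : Y - 1 ≠ 0 := h1.ne'
    have : Y ≠ 0 := by linarith
    have : Y + 1 ≠ 0 := by linarith
    have : X + 2 ≠ 0 := by linarith
    field_simp
    ring
  rw [e]
  positivity

/-! ### Positivity of the defect. -/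

lemma numNodes_add_numCells (L : ℕ) : numNodes L + numCells L = L := by
  unfold numCells numNodes
  omega

lemma numNodes_le_numCells (L : ℕ) : numNodes L ≤ numCells L := by
  unfold numCells numNodes
  omega

lemma numCells_le_numNodes_succ (L : ℕ) : numCells L ≤ numNodes L + 1 := by
  unfold numCells numNodes
  omega

/-- The combination `(β₋₁ + β₁ - 2 β₀) / 2` of the coefficients of the optimal operator. -/
noncomputable def defect (L R : ℕ) : ℝ :=
  (numCells L * numNodes L : ℝ) / ((numCells R + 1) * (numNodes R + 1))
    - (numCells R * numNodes R : ℝ) / ((numCells L + 1) * (numNodes L + 1))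
    - 2 * (harm (numCells L) + harm (numNodes L) - harm (numCells R) - harm (numNodes R))

lemma four_mul_numCells_mul_numNodes (L : ℕ) :
    (L : ℝ) ^ 2 - 1 ≤ 4 * (numCells L * numNodes L) ∧
      (4 : ℝ) * (numCells L * numNodes L) ≤ L ^ 2 := by
  have h1 : (numNodes L : ℝ) + numCells L = L := by exact_mod_cast numNodes_add_numCells L
  have h2 : (numNodes L : ℝ) ≤ numCells L := by exact_mod_cast numNodes_le_numCells L
  have h3 : (numCells L : ℝ) ≤ numNodes L + 1 := by exact_mod_cast numCells_le_numNodes_succ L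
  rw [← h1]
  constructor <;> nlinarith

lemma defect_pos_of_poly {L R : ℕ} (hR : 1 ≤ R) (hRL : R + 1 ≤ L)
    (h : 0 < (((L : ℝ) + 1) ^ 4 - 4 * ((L : ℝ) + 1) ^ 2 - (((R : ℝ) + 1) ^ 2 - 1) ^ 2)
        * ((R : ℝ) + 1) * (((R : ℝ) + 1) - 1)
      - 2 * (((L : ℝ) + 1) ^ 2 - ((R : ℝ) + 1) ^ 2) * (((R : ℝ) + 1) + 1) ^ 2
        * (((L : ℝ) + 1) + 2) * (((R : ℝ) + 1) - 1)
      - 2 * (((R : ℝ) + 1) + 1) * ((L : ℝ) + 1) * (((L : ℝ) + 1) + 2) * ((R : ℝ) + 1)) :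
    0 < defect L R := by
  have hR' : (1 : ℝ) ≤ R := by exact_mod_cast hR
  have hL' : (R : ℝ) + 1 ≤ L := by exact_mod_cast hRL
  have key := rational_lt (by linarith) (by linarith) h
  have hlog := two_mul_log_le_sub_inv (y := ((L : ℝ) + 1) / ((R : ℝ) + 1))
    (by rw [le_div_iff₀ (by linarith)]; linarith)
  have hc := harm_sub_le_log (m := numCells R) (n := numCells L) (by unfold numCells numNodes; omega)
  have hn := harm_sub_le_log (m := numNodes R) (n := numNodes L) (by unfold numNodes; omega)
  obtain ⟨l1, l2⟩ := four_mul_numCells_mul_numNodes L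
  obtain ⟨r1, r2⟩ := four_mul_numCells_mul_numNodes R
  have hl : (numNodes L : ℝ) + numCells L = L := by exact_mod_cast numNodes_add_numCells L
  have hr : (numNodes R : ℝ) + numCells R = R := by exact_mod_cast numNodes_add_numCells R
  unfold defect
  generalize (numCells L) = l at *
  generalize (numNodes L) = l' at *
  generalize (numCells R) = r at *
  generalize (numNodes R) = r' at *
  have hP : ((L : ℝ) + 1) * (((L : ℝ) + 1) - 2) / (((R : ℝ) + 1) + 1) ^ 2
      ≤ (l * l' : ℝ) / ((r + 1) * (r' + 1)) := by
    rw [div_le_div_iff₀ (by positivity) (by positivity)]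
    have a1 : 4 * ((r + 1) * (r' + 1) : ℝ) ≤ (((R : ℝ) + 1) + 1) ^ 2 := by linarith
    have a2 : ((L : ℝ) + 1) * (((L : ℝ) + 1) - 2) ≤ 4 * (l * l' : ℝ) := by linarith
    have := mul_le_mul a2 a1 (by positivity) (by positivity)
    linarith
  have hQ : (r * r' : ℝ) / ((l + 1) * (l' + 1))
      ≤ (((R : ℝ) + 1) - 1) ^ 2 / (((L : ℝ) + 1) * (((L : ℝ) + 1) + 2)) := by
    rw [div_le_div_iff₀ (by positivity) (by positivity)]
    have a1 : ((L : ℝ) + 1) * (((L : ℝ) + 1) + 2) ≤ 4 * ((l + 1) * (l' + 1) : ℝ) := by linarith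
    have a2 : 4 * (r * r' : ℝ) ≤ (((R : ℝ) + 1) - 1) ^ 2 := by linarith
    have := mul_le_mul a2 a1 (by positivity) (by positivity)
    linarith
  -- The two logarithms merge, since `(2l+1)(2l'+1) ≤ (L+1)²` and `(2r+1)(2r'+1) ≥ (R+1)² - 1`. The
  -- lost `1` accounts for odd `R` and costs the last term.
  have hsum : Real.log ((2 * l + 1) / (2 * r + 1)) + Real.log ((2 * l' + 1) / (2 * r' + 1))
      ≤ 2 * Real.log (((L : ℝ) + 1) / ((R : ℝ) + 1)) + 1 / (((R : ℝ) + 1) ^ 2 - 1) := by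
    have p1 : 0 < ((R : ℝ) + 1) ^ 2 - 1 := by nlinarith
    have b1 : (((2 * l + 1) / (2 * r + 1)) * ((2 * l' + 1) / (2 * r' + 1)) : ℝ)
        ≤ (((L : ℝ) + 1) / ((R : ℝ) + 1)) ^ 2 * (1 + 1 / (((R : ℝ) + 1) ^ 2 - 1)) := by
      have e1 : (((L : ℝ) + 1) / ((R : ℝ) + 1)) ^ 2 * (1 + 1 / (((R : ℝ) + 1) ^ 2 - 1))
          = ((L : ℝ) + 1) ^ 2 / (((R : ℝ) + 1) ^ 2 - 1) := by
        have := p1.ne'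
        field_simp
        ring
      rw [e1, div_mul_div_comm, div_le_div_iff₀ (by positivity) p1]
      have c1 : (2 * l + 1 : ℝ) * (2 * l' + 1) = 4 * (l * l') + 2 * L + 1 := by
        rw [← hl]
        ring
      have c2 : (2 * r + 1 : ℝ) * (2 * r' + 1) = 4 * (r * r') + 2 * R + 1 := by
        rw [← hr]
        ring
      exact mul_le_mul (by linarith) (by linarith) p1.le (by positivity)
    have b2 := Real.log_le_log (by positivity) b1
    rw [Real.log_mul (by positivity) (by positivity), Real.log_mul (by positivity) (by positivity),
      Real.log_pow] at b2
    have b3 := Real.log_le_sub_one_of_pos (x := 1 + 1 / (((R : ℝ) + 1) ^ 2 - 1)) (by positivity)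
    push_cast at b2
    linarith
  have e3 : 2 / (((R : ℝ) + 1) ^ 2 - 1) = 2 * (1 / (((R : ℝ) + 1) ^ 2 - 1)) := by ring
  linarith

/-- For strongly upwinded stencils the defect is positive. -/
theorem defect_pos {L R : ℕ}
    (h : min (2 * (R : ℝ) + 7) (9 + Real.sqrt (21 * (R : ℝ) + 49)) ≤ (L : ℝ) - R) :
    0 < defect L R := by
  have hlin : 3 * R + 7 ≤ L → 0 < defect L R := by
    intro hL
    -- For `R ≤ 1` the polynomial estimate is not available, but `r' = 0` kills the second fraction
    -- and a linear bound on harmonic numbers suffices.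
    rcases Nat.lt_or_ge R 2 with hR | hR
    · have h1 : (numNodes L : ℝ) + numCells L = L := by exact_mod_cast numNodes_add_numCells L
      have hc := harm_le_linear (numCells L)
      have hn := harm_le_linear (numNodes L)
      interval_cases R
      · have h2 : (3 : ℝ) ≤ numNodes L := by
          exact_mod_cast (by unfold numNodes; omega : 3 ≤ numNodes L)
        have h3 : (4 : ℝ) ≤ numCells L := by
          exact_mod_cast (by unfold numCells numNodes; omega : 4 ≤ numCells L)
        simp only [defect, numCells, numNodes] at *
        norm_num [harm]
        simp only [harm, one_div] at hc hn
        nlinarith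
      · have h2 : (5 : ℝ) ≤ numNodes L := by
          exact_mod_cast (by unfold numNodes; omega : 5 ≤ numNodes L)
        have h3 : (5 : ℝ) ≤ numCells L := by
          exact_mod_cast (by unfold numCells numNodes; omega : 5 ≤ numCells L)
        simp only [defect, numCells, numNodes] at *
        norm_num [harm]
        simp only [harm, one_div] at hc hn
        nlinarith
    · have hR' : (2 : ℝ) ≤ R := by exact_mod_cast hR
      have hL' : 3 * (R : ℝ) + 7 ≤ L := by exact_mod_cast hL
      exact defect_pos_of_poly (by omega) (by omega)
        (poly_pos_of_linear (by linarith) (by linarith))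
  rcases min_le_iff.1 h with h | h
  · apply hlin
    have : 3 * (R : ℝ) + 7 ≤ L := by linarith
    exact_mod_cast this
  -- Up to `R = 8` one has `2R + 7 ≤ 9 + √(21R + 49)`, so the linear case applies.
  · rcases Nat.lt_or_ge R 9 with hR | hR
    · apply hlin
      have hR' : (R : ℝ) ≤ 8 := by exact_mod_cast (by omega : R ≤ 8)
      have : 2 * (R : ℝ) - 2 ≤ Real.sqrt (21 * (R : ℝ) + 49) := by
        apply Real.le_sqrt_of_sq_le
        nlinarith [(Nat.cast_nonneg R : (0 : ℝ) ≤ R)]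
      have : 3 * (R : ℝ) + 7 ≤ L := by linarith
      exact_mod_cast this
    · have hR' : (9 : ℝ) ≤ R := by exact_mod_cast hR
      have hs := Real.sq_sqrt (by positivity : 0 ≤ 21 * (R : ℝ) + 49)
      have h15 : 15 ≤ Real.sqrt (21 * (R : ℝ) + 49) :=
        Real.le_sqrt_of_sq_le (by linarith)
      have hq : 21 * (R : ℝ) + 49 ≤ ((L : ℝ) - R - 9) ^ 2 := by
        rw [← hs]
        exact pow_le_pow_left₀ (by linarith) (by linarith) 2
      have hp := poly_pos_of_sq (Y := (R : ℝ) + 1) (D := (L : ℝ) - R) (by linarith) (by linarith)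
        (by nlinarith)
      rw [show (R : ℝ) + 1 + ((L : ℝ) - R) = L + 1 by ring] at hp
      refine defect_pos_of_poly (by omega) ?_ hp
      have : (R : ℝ) + 1 ≤ L := by linarith
      exact_mod_cast this

end HV

/-! ### Exactness on polynomials. -/

namespace HV

open Polynomial

namespace DDO

variable {L R : ℕ}

/-- The operator with unit grid size at the origin, applied to the derivative of a polynomial. -/
noncomputable def unitFunctional (D : DDO L R) : ℝ[X] →ₗ[ℝ] ℝ :=
  ∑ k ∈ cells L R, D.α k • (leval ((k : ℝ) + 1) - leval (k : ℝ))
    + ∑ k ∈ nodes L R, D.β k • (leval (k : ℝ) ∘ₗ derivative)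

lemma unitFunctional_apply (D : DDO L R) (V : ℝ[X]) :
    D.unitFunctional V = ∑ k ∈ cells L R, D.α k * (V.eval ((k : ℝ) + 1) - V.eval (k : ℝ))
      + ∑ k ∈ nodes L R, D.β k * V.derivative.eval (k : ℝ) := by
  simp [unitFunctional, leval]

lemma apply_pow_zero (D : DDO L R) (n : ℕ) {h : ℝ} (hh : h ≠ 0) :
    D.apply (fun y => y ^ n) h 0 * (h * (n + 1)) = h ^ n * D.unitFunctional (X ^ (n + 1)) := by
  have hn : (n : ℝ) + 1 ≠ 0 := by positivity
  rw [unitFunctional_apply]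
  unfold apply cellAverage
  simp only [integral_pow, eval_pow, eval_X, derivative_X_pow, eval_mul, eval_C, zero_add,
    Nat.add_sub_cancel]
  rw [add_mul, mul_add (h ^ n), Finset.mul_sum, Finset.mul_sum, Finset.mul_sum, Finset.mul_sum,
    Finset.sum_mul, Finset.sum_mul]
  congr 1
  · refine Finset.sum_congr rfl fun k _ => ?_
    have e : (k : ℝ) * h + h = (k + 1) * h := by ring
    rw [e, mul_pow, mul_pow]
    field_simp
    ring
  · refine Finset.sum_congr rfl fun k _ => ?_
    rw [mul_pow]
    push_cast
    field_simp

/-- By homogeneity, the error on `yⁿ` at the origin, multiplied by `h(n+1)`, is exactly `E hⁿ`. It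
is also `O(h^(p+2))`, and `n ≤ p`, so `E = 0`. -/
lemma unitFunctional_X_pow {D : DDO L R} {p : ℕ} (hD : D.HasOrder p) {n : ℕ} (hn : n ≤ p) :
    D.unitFunctional (X ^ (n + 1)) = (derivative (derivative (X ^ (n + 1) : ℝ[X]))).eval 0 := by
  obtain ⟨c, -, hc⟩ := hD
  have h1 := hc (fun y => y ^ n) (by fun_prop) 0
  have hn1 : (n : ℝ) + 1 ≠ 0 := by positivity
  have e2 : (derivative (derivative (X ^ (n + 1) : ℝ[X]))).eval 0
      = (n + 1) * (n * (0 : ℝ) ^ (n - 1)) := by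
    simp [derivative_X_pow]
  rw [e2]
  set E : ℝ := D.unitFunctional (X ^ (n + 1)) - (n + 1) * (n * (0 : ℝ) ^ (n - 1)) with hE
  have h2 : ∀ᶠ h : ℝ in 𝓝[>] 0, (D.apply (fun y => y ^ n) h 0
      - (deriv (fun y : ℝ => y ^ n) 0 + c * iteratedDeriv (p + 1) (fun y : ℝ => y ^ n) 0 * h ^ p))
      * (h * (n + 1)) = E * h ^ n := by
    filter_upwards [self_mem_nhdsWithin] with h hh
    have hh' : h ≠ 0 := (Set.mem_Ioi.1 hh).ne'
    have e3 : deriv (fun y : ℝ => y ^ n) 0 = n * (0 : ℝ) ^ (n - 1) := by simp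
    rw [iteratedDeriv_fun_pow_zero, if_neg (by omega), e3, sub_mul, apply_pow_zero D n hh', hE]
    -- The coefficient, the derivative of `yⁿ` at `0`, is nonzero only for `n = 1`.
    have e4 : n * (0 : ℝ) ^ (n - 1) * h = n * (0 : ℝ) ^ (n - 1) * h ^ n := by
      rcases Nat.lt_trichotomy n 1 with h0 | h0 | h0
      · interval_cases n
        simp
      · subst h0
        simp
      · rw [zero_pow (by omega)]
        simp
    linear_combination (-(n : ℝ) - 1) * e4
  have h3 : (fun h : ℝ => E * h ^ n) =o[𝓝[>] (0 : ℝ)] (fun h : ℝ => h ^ n) := by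
    have h4 : (fun h : ℝ => E * h ^ n) =O[𝓝[>] (0 : ℝ)] (fun h : ℝ => h ^ (p + 1) * (h * (n + 1))) :=
      (h1.mul (Asymptotics.isBigO_refl (fun h : ℝ => h * ((n : ℝ) + 1)) _)).congr' h2
        Filter.EventuallyEq.rfl
    refine h4.trans_isLittleO ?_
    have h5 : (fun h : ℝ => h ^ (p - n) * (h * (h * (n + 1)))) =o[𝓝[>] (0 : ℝ)]
        (fun _ : ℝ => (1 : ℝ)) := by
      rw [Asymptotics.isLittleO_one_iff]
      have : ContinuousAt (fun h : ℝ => h ^ (p - n) * (h * (h * ((n : ℝ) + 1)))) 0 := by fun_prop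
      have h6 := this.tendsto
      simp only [zero_mul, mul_zero] at h6
      exact h6.mono_left nhdsWithin_le_nhds
    have h7 := (Asymptotics.isBigO_refl (fun h : ℝ => h ^ n) (𝓝[>] (0 : ℝ))).mul_isLittleO h5
    refine h7.congr' (Filter.Eventually.of_forall fun h => ?_)
      (Filter.Eventually.of_forall fun h => by simp)
    have : h ^ (p + 1) = h ^ n * h ^ (p - n) * h := by
      rw [← pow_add, ← pow_succ]
      congr 2
      omega
    simp only [this]
    ring
  have h8 := h3.tendsto_div_nhds_zero
  have h9 : Filter.Tendsto (fun h : ℝ => E * h ^ n / h ^ n) (𝓝[>] (0 : ℝ)) (𝓝 E) := by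
    refine tendsto_const_nhds.congr' ?_
    filter_upwards [self_mem_nhdsWithin] with h hh
    have hh' : h ≠ 0 := (Set.mem_Ioi.1 hh).ne'
    field_simp
  have := tendsto_nhds_unique h9 h8
  linarith

/-- An operator of order `p` differentiates polynomials of degree `≤ p` exactly. -/
theorem unitFunctional_eq {D : DDO L R} {p : ℕ} (hD : D.HasOrder p) {V : ℝ[X]}
    (hV : V.natDegree ≤ p + 1) :
    D.unitFunctional V = (derivative (derivative V)).eval 0 := by
  rw [V.as_sum_range_C_mul_X_pow' (n := p + 2) (by omega)]
  simp only [map_sum, eval_finsetSum]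
  refine Finset.sum_congr rfl fun i hi => ?_
  rw [Finset.mem_range] at hi
  rw [← smul_eq_C_mul, map_smul, derivative_smul, derivative_smul, eval_smul]
  congr 1
  rcases i with _ | n
  · simp [unitFunctional_apply]
  · exact unitFunctional_X_pow hD (by omega)

end DDO

/-! ### Nodal polynomials. -/

/-- The monic polynomial whose roots are the integers in `[-m, n]` other than `k`. -/
noncomputable def nodal (m n : ℕ) (k : ℤ) : ℝ[X] :=
  ∏ j ∈ (Finset.Icc (-(m : ℤ)) n).erase k, (X - C (j : ℝ))

lemma prod_erase_zero {M : Type*} [CommMonoid M] (f : ℤ → M) (m n : ℕ) :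
    ∏ j ∈ (Finset.Icc (-(m : ℤ)) n).erase 0, f j
      = (∏ i ∈ Finset.range m, f (-((i : ℤ) + 1))) * ∏ i ∈ Finset.range n, f ((i : ℤ) + 1) := by
  induction m with
  | zero =>
    simp only [Finset.range_zero, Finset.prod_empty, one_mul]
    induction n with
    | zero => simp
    | succ n ih =>
      have : (Finset.Icc (-((0 : ℕ) : ℤ)) ((n + 1 : ℕ) : ℤ)).erase 0
          = insert ((n : ℤ) + 1) ((Finset.Icc (-((0 : ℕ) : ℤ)) (n : ℤ)).erase 0) := by
        ext j
        simp only [Finset.mem_erase, Finset.mem_Icc, Finset.mem_insert]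
        omega
      rw [this, Finset.prod_insert (by simp), ih, Finset.prod_range_succ, mul_comm]
  | succ m ih =>
    have : (Finset.Icc (-((m + 1 : ℕ) : ℤ)) (n : ℤ)).erase 0
        = insert (-((m : ℤ) + 1)) ((Finset.Icc (-(m : ℤ)) (n : ℤ)).erase 0) := by
      ext j
      simp only [Finset.mem_erase, Finset.mem_Icc, Finset.mem_insert]
      omega
    rw [this, Finset.prod_insert (by simp), ih, Finset.prod_range_succ]
    simp only [mul_comm, mul_left_comm]

/-- Replacing the erased factor by `1` keeps the index set fixed, so the product still splits at
`0`. -/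
lemma prod_erase_eq {M : Type*} [CommMonoid M] (f : ℤ → M) {m n : ℕ} {k : ℤ}
    (hk : k ∈ Finset.Icc (-(m : ℤ)) n) :
    ∏ j ∈ (Finset.Icc (-(m : ℤ)) n).erase k, f j
      = (if 0 = k then 1 else f 0) * ((∏ i ∈ Finset.range m, if -((i : ℤ) + 1) = k then 1
        else f (-((i : ℤ) + 1))) * ∏ i ∈ Finset.range n, if (i : ℤ) + 1 = k then 1
        else f ((i : ℤ) + 1)) := by
  rw [← prod_erase_zero (fun j => if j = k then 1 else f j) m n,
    Finset.mul_prod_erase _ (fun j => if j = k then 1 else f j) (by simp),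
    ← Finset.mul_prod_erase _ (fun j => if j = k then 1 else f j) hk, if_pos rfl, one_mul]
  refine Finset.prod_congr rfl fun j hj => ?_
  rw [if_neg (Finset.ne_of_mem_erase hj)]

lemma eval_nodal_zero (m n : ℕ) :
    (nodal m n 0).eval 0
      = (∏ i ∈ Finset.range m, ((i : ℝ) + 1)) * ∏ i ∈ Finset.range n, (-((i : ℝ) + 1)) := by
  rw [nodal, eval_prod, prod_erase_zero]
  simp

lemma eval_nodal_self_ne_zero (m n : ℕ) (k : ℤ) : (nodal m n k).eval (k : ℝ) ≠ 0 := by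
  rw [nodal, eval_prod, Finset.prod_ne_zero_iff]
  intro j hj
  simp only [eval_sub, eval_X, eval_C, sub_ne_zero]
  exact_mod_cast (Finset.ne_of_mem_erase hj).symm

lemma prod_shift_pos (n : ℕ) :
    ∏ i ∈ Finset.range n, ((i : ℝ) + 2) = (n + 1) * ∏ i ∈ Finset.range n, ((i : ℝ) + 1) := by
  induction n with
  | zero => simp
  | succ n ih =>
    rw [Finset.prod_range_succ, Finset.prod_range_succ, ih]
    push_cast
    ring

lemma prod_shift_neg (n : ℕ) :
    ∏ i ∈ Finset.range n, (-((i : ℝ) + 2)) = (n + 1) * ∏ i ∈ Finset.range n, (-((i : ℝ) + 1)) := by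
  induction n with
  | zero => simp
  | succ n ih =>
    rw [Finset.prod_range_succ, Finset.prod_range_succ, ih]
    push_cast
    ring

/-- The values at `-1` and `0` are `-(-1)ⁿ (m-1)! (n+1)!` and `(-1)ⁿ m! n!`. -/
lemma eval_nodal_neg_one {m : ℕ} (n : ℕ) (hm : 1 ≤ m) :
    (nodal m n (-1)).eval (-1) * m = -((n + 1) * (nodal m n 0).eval 0) := by
  obtain ⟨m, rfl⟩ := Nat.exists_eq_add_of_le' hm
  have hk : (-1 : ℤ) ∈ Finset.Icc (-((m + 1 : ℕ) : ℤ)) n := by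
    simp only [Finset.mem_Icc]
    omega
  rw [eval_nodal_zero, nodal, eval_prod, prod_erase_eq _ hk, Finset.prod_range_succ',
    Finset.prod_range_succ]
  have e1 : ∀ i : ℕ, (if -(((i + 1 : ℕ) : ℤ) + 1) = -1 then (1 : ℝ)
      else eval (-1) (X - C ((-(((i + 1 : ℕ) : ℤ) + 1) : ℤ) : ℝ))) = (i : ℝ) + 1 := by
    intro i
    rw [if_neg (by omega)]
    simp
  have e2 : ∀ i : ℕ, (if (i : ℤ) + 1 = -1 then (1 : ℝ)
      else eval (-1) (X - C (((i : ℤ) + 1 : ℤ) : ℝ))) = -((i : ℝ) + 2) := by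
    intro i
    rw [if_neg (by omega)]
    simp
    ring
  simp only [e1, e2, prod_shift_neg]
  simp
  ring

lemma eval_nodal_one {n : ℕ} (m : ℕ) (hn : 1 ≤ n) :
    (nodal m n 1).eval 1 * n = -((m + 1) * (nodal m n 0).eval 0) := by
  obtain ⟨n, rfl⟩ := Nat.exists_eq_add_of_le' hn
  have hk : (1 : ℤ) ∈ Finset.Icc (-(m : ℤ)) ((n + 1 : ℕ) : ℤ) := by
    simp only [Finset.mem_Icc]
    omega
  rw [eval_nodal_zero, nodal, eval_prod, prod_erase_eq _ hk, Finset.prod_range_succ',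
    Finset.prod_range_succ]
  have e1 : ∀ i : ℕ, (if ((i + 1 : ℕ) : ℤ) + 1 = 1 then (1 : ℝ)
      else eval 1 (X - C (((((i + 1 : ℕ) : ℤ) + 1 : ℤ)) : ℝ))) = -((i : ℝ) + 1) := by
    intro i
    rw [if_neg (by omega)]
    simp
  have e2 : ∀ i : ℕ, (if -((i : ℤ) + 1) = 1 then (1 : ℝ)
      else eval 1 (X - C ((-((i : ℤ) + 1) : ℤ) : ℝ))) = (i : ℝ) + 2 := by
    intro i
    rw [if_neg (by omega)]
    simp
    ring
  simp only [e1, e2, prod_shift_pos]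
  simp
  ring

/-- The logarithmic derivative at `0` is the sum of `-1/j` over the roots `j`. -/
lemma eval_derivative_nodal_zero (m n : ℕ) :
    (derivative (nodal m n 0)).eval 0 = (nodal m n 0).eval 0 * (harm m - harm n) := by
  have hs : ∀ s : Finset ℤ, 0 ∉ s →
      (derivative (∏ j ∈ s, (X - C (j : ℝ)))).eval 0
        = (∏ j ∈ s, (X - C (j : ℝ))).eval 0 * ∑ j ∈ s, (-(j : ℝ))⁻¹ := by
    intro s
    induction s using Finset.induction_on with
    | empty => simp
    | insert a s ha ih =>
      intro h0
      have ha0 : (a : ℝ) ≠ 0 := by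
        rintro h
        exact h0 (by simp [Int.cast_eq_zero.1 h])
      rw [Finset.prod_insert ha, Finset.sum_insert ha, derivative_mul, eval_add, eval_mul,
        eval_mul, ih (fun h => h0 (Finset.mem_insert_of_mem h)), eval_mul]
      simp only [derivative_sub, derivative_X, derivative_C, sub_zero, eval_one, eval_sub, eval_X,
        eval_C, zero_sub]
      field_simp
      ring
  rw [nodal, hs _ (by simp)]
  congr 1
  -- `Multiplicative ℝ` turns the product splitting into a splitting of sums.
  have := prod_erase_zero (M := Multiplicative ℝ)
    (fun j => Multiplicative.ofAdd (-(j : ℝ))⁻¹) m n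
  have h2 := congrArg Multiplicative.toAdd this
  simp only [toAdd_prod, toAdd_mul, toAdd_ofAdd] at h2
  rw [h2, sub_eq_add_neg, harm, harm, ← Finset.sum_neg_distrib]
  congr 1
  · refine Finset.sum_congr rfl fun i _ => ?_
    push_cast
    rw [neg_neg, one_div]
  · refine Finset.sum_congr rfl fun i _ => ?_
    push_cast
    rw [inv_neg, one_div]

/-! ### Coefficients of the optimal operator. -/

namespace DDO

variable {L R : ℕ}

lemma natDegree_nodal_le (m n : ℕ) {k : ℤ} (hk : k ∈ Finset.Icc (-(m : ℤ)) n) :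
    (nodal m n k).natDegree ≤ m + n := by
  refine (natDegree_prod_le _ _).trans ((Finset.sum_le_card_nsmul _ _ 1 fun j _ =>
    natDegree_X_sub_C_le _).trans ?_)
  rw [Finset.card_erase_of_mem hk, Int.card_Icc]
  simp only [smul_eq_mul, mul_one]
  omega

lemma X_sub_mul_nodal {m n : ℕ} {k : ℤ} (hk : k ∈ Finset.Icc (-(m : ℤ)) n) :
    (X - C (k : ℝ)) * nodal m n k = ∏ j ∈ Finset.Icc (-(m : ℤ)) n, (X - C (j : ℝ)) :=
  Finset.mul_prod_erase _ (fun j : ℤ => X - C (j : ℝ)) hk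

/-- The coefficients `β` of the optimal operator are those of Hermite interpolation. -/
lemma beta_mul_nodal {D : DDO L R} (hD : D.IsOptimal) {k : ℤ} (hk : k ∈ nodes L R) :
    D.β k * ((nodal (numCells L) (numCells R) k).eval (k : ℝ)
        * (nodal (numNodes L) (numNodes R) k).eval (k : ℝ))
      = 2 * ((derivative (nodal (numCells L) (numCells R) 0)).eval 0
          * (nodal (numNodes L) (numNodes R) k).eval 0
        + (nodal (numCells L) (numCells R) 0).eval 0
          * (derivative (nodal (numNodes L) (numNodes R) k)).eval 0) := by
  have hL := numNodes_le_numCells L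
  have hR := numNodes_le_numCells R
  have hL2 := numNodes_add_numCells L
  have hR2 := numNodes_add_numCells R
  have hk' := Finset.mem_Icc.1 hk
  have hkc : k ∈ Finset.Icc (-(numCells L : ℤ)) (numCells R : ℤ) := by
    rw [Finset.mem_Icc]
    omega
  have h0c : (0 : ℤ) ∈ Finset.Icc (-(numCells L : ℤ)) (numCells R : ℤ) := by simp
  -- The test polynomial is `A * B`. `A` vanishes at all cell endpoints, which removes every `α`;
  -- the product has double zeros at all nodes but `k`, which removes every other `β`. Its degree `L
  -- + R + 1` is just within reach of exactness.
  set A : ℝ[X] := ∏ j ∈ Finset.Icc (-(numCells L : ℤ)) (numCells R : ℤ), (X - C (j : ℝ)) with hA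
  have hAk := X_sub_mul_nodal hkc
  have hA0 := X_sub_mul_nodal h0c
  rw [← hA] at hAk hA0
  have hAz : ∀ j ∈ Finset.Icc (-(numCells L : ℤ)) (numCells R : ℤ), A.eval (j : ℝ) = 0 := by
    intro j hj
    rw [hA, ← X_sub_mul_nodal hj]
    simp
  set B := nodal (numNodes L) (numNodes R) k with hB
  have hdeg : (A * B).natDegree ≤ L + R + 1 := by
    have h1 : A.natDegree ≤ numCells L + numCells R + 1 := by
      rw [← hAk, add_comm _ 1]
      exact natDegree_mul_le.trans
        (add_le_add (natDegree_X_sub_C_le _) (natDegree_nodal_le _ _ hkc))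
    have h2 : B.natDegree ≤ numNodes L + numNodes R := natDegree_nodal_le _ _ hk
    have := natDegree_mul_le (p := A) (q := B)
    omega
  have h := unitFunctional_eq hD hdeg
  rw [unitFunctional_apply, Finset.sum_eq_zero, zero_add, Finset.sum_eq_single_of_mem k hk] at h
  · have e1 : (derivative (A * B)).eval (k : ℝ)
        = (nodal (numCells L) (numCells R) k).eval (k : ℝ) * B.eval (k : ℝ) := by
      rw [← hAk]
      simp [derivative_mul]
    rw [e1] at h
    rw [h, ← hA0]
    simp [derivative_mul]
    ring
  · intro j hj hjk
    have e1 : B.eval (j : ℝ) = 0 := by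
      rw [hB, nodal, eval_prod]
      exact Finset.prod_eq_zero (Finset.mem_erase.2 ⟨hjk, hj⟩) (by simp)
    have hj' := Finset.mem_Icc.1 hj
    have e2 := hAz j (by rw [Finset.mem_Icc]; omega)
    simp [derivative_mul, e1, e2]
  · intro j hj
    have hj' := Finset.mem_Ico.1 hj
    have e1 := hAz j (by rw [Finset.mem_Icc]; omega)
    have e2 := hAz (j + 1) (by rw [Finset.mem_Icc]; omega)
    push_cast at e2
    simp [e1, e2]

lemma beta_zero {D : DDO L R} (hD : D.IsOptimal) :
    D.β 0 = 2 * (harm (numCells L) + harm (numNodes L) - harm (numCells R) - harm (numNodes R)) := by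
  have h := beta_mul_nodal hD (k := 0) (by simp [nodes])
  have h1 := eval_nodal_self_ne_zero (numCells L) (numCells R) 0
  have h2 := eval_nodal_self_ne_zero (numNodes L) (numNodes R) 0
  simp only [Int.cast_zero, eval_derivative_nodal_zero] at h h1 h2
  apply mul_right_cancel₀ (mul_ne_zero h1 h2)
  rw [h]
  ring

/-- For `k ≠ 0`, the value and derivative at `0` of `(X - k) nodal_k = X nodal_0` give `nodal_k(0) =
0` and `-k nodal_k'(0) = nodal_0(0)`. -/
lemma neg_mul_beta_mul_nodal {D : DDO L R} (hD : D.IsOptimal) {k : ℤ} (hk : k ∈ nodes L R)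
    (hk0 : k ≠ 0) :
    -k * D.β k * ((nodal (numCells L) (numCells R) k).eval (k : ℝ)
        * (nodal (numNodes L) (numNodes R) k).eval (k : ℝ))
      = 2 * ((nodal (numCells L) (numCells R) 0).eval 0
        * (nodal (numNodes L) (numNodes R) 0).eval 0) := by
  have h := beta_mul_nodal hD hk
  have h0 : (0 : ℤ) ∈ nodes L R := by simp [nodes]
  have e := (X_sub_mul_nodal hk).trans (X_sub_mul_nodal h0).symm
  have e1 := congrArg (eval 0) e
  have e2 := congrArg (fun q => eval 0 (derivative q)) e
  have hk' : (k : ℝ) ≠ 0 := by exact_mod_cast hk0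
  simp [derivative_mul, hk0] at e1 e2
  rw [e1] at h e2
  rw [mul_assoc, h, ← e2]
  ring

lemma beta_neg_one {D : DDO L R} (hD : D.IsOptimal) (hL : 1 ≤ numNodes L) :
    D.β (-1) = 2 * ((numCells L * numNodes L : ℝ) / ((numCells R + 1) * (numNodes R + 1))) := by
  have h := neg_mul_beta_mul_nodal hD (k := -1)
    (by simp only [nodes, Finset.mem_Icc]; omega) (by norm_num)
  have hc := eval_nodal_neg_one (numCells R) (hL.trans (numNodes_le_numCells L))
  have hn := eval_nodal_neg_one (numNodes R) hL
  have h1 := eval_nodal_self_ne_zero (numCells L) (numCells R) 0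
  have h2 := eval_nodal_self_ne_zero (numNodes L) (numNodes R) 0
  push_cast at h h1 h2
  rw [mul_div_assoc', eq_div_iff (by positivity)]
  apply mul_right_cancel₀ (mul_ne_zero h1 h2)
  generalize (nodal (numCells L) (numCells R) (-1)).eval (-1) = a at *
  generalize (nodal (numNodes L) (numNodes R) (-1)).eval (-1) = b at *
  generalize (nodal (numCells L) (numCells R) 0).eval 0 = a0 at *
  generalize (nodal (numNodes L) (numNodes R) 0).eval 0 = b0 at *
  have e : ((numCells R : ℝ) + 1) * a0 * ((numNodes R + 1) * b0)
      = a * numCells L * (b * numNodes L) := by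
    rw [hc, hn]
    ring
  linear_combination D.β (-1) * e + numCells L * numNodes L * h

lemma beta_one {D : DDO L R} (hD : D.IsOptimal) (hR : 1 ≤ numNodes R) :
    D.β 1 = -(2 * ((numCells R * numNodes R : ℝ) / ((numCells L + 1) * (numNodes L + 1)))) := by
  have h := neg_mul_beta_mul_nodal hD (k := 1)
    (by simp only [nodes, Finset.mem_Icc]; omega) (by norm_num)
  have hc := eval_nodal_one (numCells L) (hR.trans (numNodes_le_numCells R))
  have hn := eval_nodal_one (numNodes L) hR
  have h1 := eval_nodal_self_ne_zero (numCells L) (numCells R) 0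
  have h2 := eval_nodal_self_ne_zero (numNodes L) (numNodes R) 0
  push_cast at h h1 h2
  rw [mul_div_assoc', ← neg_div, eq_div_iff (by positivity)]
  apply mul_right_cancel₀ (mul_ne_zero h1 h2)
  generalize (nodal (numCells L) (numCells R) 1).eval 1 = a at *
  generalize (nodal (numNodes L) (numNodes R) 1).eval 1 = b at *
  generalize (nodal (numCells L) (numCells R) 0).eval 0 = a0 at *
  generalize (nodal (numNodes L) (numNodes R) 0).eval 0 = b0 at *
  have e : ((numCells L : ℝ) + 1) * a0 * ((numNodes L + 1) * b0)
      = a * numCells R * (b * numNodes R) := by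
    rw [hc, hn]
    ring
  linear_combination D.β 1 * e - numCells R * numNodes R * h

end DDO

end HV

/-! ### Averaging over roots of unity. -/

namespace HV

lemma sum_cos_eq_zero {N : ℕ} {j : ℤ} (hN : 0 < N) (hj : ¬ (N : ℤ) ∣ j) :
    ∑ m ∈ Finset.range N, Real.cos (j * (2 * Real.pi * m / N)) = 0 := by
  have hp := Complex.isPrimitiveRoot_exp N hN.ne'
  set ζ := Complex.exp (2 * Real.pi * Complex.I / N) with hζ
  have h1 : ζ ^ j ≠ 1 := fun h => hj ((hp.zpow_eq_one_iff_dvd j).1 h)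
  have h2 : ∑ m ∈ Finset.range N, (ζ ^ j) ^ m = 0 := by
    apply eq_zero_of_ne_zero_of_mul_left_eq_zero (sub_ne_zero.2 h1)
    rw [mul_geom_sum, ← zpow_natCast, ← zpow_mul, mul_comm, zpow_mul, zpow_natCast, hp.pow_eq_one]
    simp
  have h3 := congrArg Complex.re h2
  rw [Complex.re_sum, Complex.zero_re] at h3
  rw [← h3]
  refine Finset.sum_congr rfl fun m _ => ?_
  rw [hζ, ← Complex.exp_int_mul, ← Complex.exp_nat_mul, ← Complex.exp_ofReal_mul_I_re]
  congr 2
  push_cast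
  ring

lemma sum_cos_eq {N : ℕ} {j : ℤ} (hj : |j| < N) :
    ∑ m ∈ Finset.range N, Real.cos (j * (2 * Real.pi * m / N)) = if j = 0 then (N : ℝ) else 0 := by
  split_ifs with h
  · simp [h]
  · have hN : 0 < N := by
      have := abs_nonneg j
      omega
    exact sum_cos_eq_zero hN fun hd => h (Int.eq_zero_of_abs_lt_dvd hd hj)

/-- The product expands into the frequencies `k` and `k ± 1`; the bound on `|k|` keeps them all
below `N` in absolute value, so orthogonality applies without aliasing. -/
lemma sum_cos_mul_one_sub_cos {N : ℕ} {k : ℤ} (hk : |k| + 1 < N) :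
    ∑ m ∈ Finset.range N, Real.cos (k * (2 * Real.pi * m / N))
        * (1 - Real.cos (2 * Real.pi * m / N))
      = N * ((if k = 0 then 1 else 0) - ((if k = -1 then 1 else 0) + (if k = 1 then 1 else 0)) / 2)
    := by
  have h1 := abs_lt.1 (by omega : |k| < N - 1)
  have e : ∀ θ : ℝ, Real.cos (k * θ) * (1 - Real.cos θ)
      = Real.cos (k * θ)
        - (Real.cos (((k + 1 : ℤ) : ℝ) * θ) + Real.cos (((k - 1 : ℤ) : ℝ) * θ)) / 2 := by
    intro θ
    push_cast
    rw [add_mul, sub_mul, one_mul, Real.cos_add, Real.cos_sub]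
    ring
  simp only [e]
  rw [Finset.sum_sub_distrib, ← Finset.sum_div, Finset.sum_add_distrib,
    sum_cos_eq (by omega), sum_cos_eq (abs_lt.2 (by omega)), sum_cos_eq (abs_lt.2 (by omega))]
  have e1 : (k + 1 = 0) ↔ k = -1 := by omega
  have e2 : (k - 1 = 0) ↔ k = 1 := by omega
  simp only [e1, e2]
  split_ifs <;> ring

namespace DDO

variable {L R : ℕ}

lemma re_H (D : DDO L R) (θ : ℝ) :
    (D.H θ).re = ∑ k ∈ nodes L R, D.β k * Real.cos (k * θ) := by
  rw [H, Complex.re_sum]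
  refine Finset.sum_congr rfl fun k _ => ?_
  rw [Complex.re_ofReal_mul, ← Complex.exp_ofReal_mul_I_re]
  congr 3
  push_cast
  ring

lemma re_H_two_pi_sub (D : DDO L R) (θ : ℝ) : (D.H (2 * Real.pi - θ)).re = (D.H θ).re := by
  rw [re_H, re_H]
  refine Finset.sum_congr rfl fun k _ => ?_
  rw [mul_sub, Real.cos_int_mul_two_pi_sub]

lemma sum_re_H_mul_one_sub_cos {D : DDO L R} (hD : D.IsOptimal) (hL : 1 ≤ numNodes L) {N : ℕ}
    (hN : L + R + 1 < N) :
    ∑ m ∈ Finset.range N, (D.H (2 * Real.pi * m / N)).re * (1 - Real.cos (2 * Real.pi * m / N))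
      = -(N * defect L R) := by
  have hL2 := numNodes_add_numCells L
  have hR2 := numNodes_add_numCells R
  simp only [re_H, Finset.sum_mul]
  rw [Finset.sum_comm]
  have e : ∀ k ∈ nodes L R, ∑ m ∈ Finset.range N, D.β k * Real.cos (k * (2 * Real.pi * m / N))
        * (1 - Real.cos (2 * Real.pi * m / N))
      = N * ((if k = 0 then D.β k else 0)
        - ((if k = -1 then D.β k else 0) + (if k = 1 then D.β k else 0)) / 2) := by
    intro k hk
    have hk' := Finset.mem_Icc.1 hk
    have hk2 : |k| ≤ L + R := abs_le.2 (by omega)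
    simp only [mul_assoc (D.β k)]
    rw [← Finset.mul_sum, sum_cos_mul_one_sub_cos (by omega)]
    split_ifs <;> ring
  rw [Finset.sum_congr rfl e, ← Finset.mul_sum, Finset.sum_sub_distrib, ← Finset.sum_div,
    Finset.sum_add_distrib]
  simp only [Finset.sum_ite_eq']
  have m0 : (0 : ℤ) ∈ nodes L R := by simp [nodes]
  have m1 : (-1 : ℤ) ∈ nodes L R := by
    simp only [nodes, Finset.mem_Icc]
    omega
  have h1 : (if (1 : ℤ) ∈ nodes L R then D.β 1 else 0)
      = -(2 * ((numCells R * numNodes R : ℝ) / ((numCells L + 1) * (numNodes L + 1)))) := by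
    split_ifs with h
    · refine beta_one hD ?_
      have := (Finset.mem_Icc.1 h).2
      omega
    · have : numNodes R = 0 := by
        by_contra h0
        exact h (by simp only [nodes, Finset.mem_Icc]; omega)
      simp [this]
  rw [if_pos m0, if_pos m1, h1, beta_zero hD, beta_neg_one hD hL, defect]
  ring

/-- If the defect is positive, `Re H` is negative at some rational multiple of `2π`. -/
lemma exists_re_H_neg {D : DDO L R} (hD : D.IsOptimal) (hL : 1 ≤ numNodes L)
    (h : 0 < defect L R) :
    ∃ N m : ℕ, 0 < m ∧ m < N ∧ (D.H (2 * Real.pi * m / N)).re < 0 := by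
  have hs := sum_re_H_mul_one_sub_cos hD hL (N := L + R + 2) (by omega)
  have hneg : -(((L + R + 2 : ℕ) : ℝ) * defect L R) < 0 := by
    rw [neg_lt_zero]
    positivity
  rw [← hs] at hneg
  obtain ⟨m, hm, hlt⟩ := Finset.exists_lt_of_sum_lt (f := fun m : ℕ =>
    (D.H (2 * Real.pi * m / ((L + R + 2 : ℕ) : ℝ))).re
      * (1 - Real.cos (2 * Real.pi * m / ((L + R + 2 : ℕ) : ℝ)))) (g := fun _ => (0 : ℝ))
    (s := Finset.range (L + R + 2)) (by simpa using hneg)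
  refine ⟨L + R + 2, m, ?_, Finset.mem_range.1 hm, ?_⟩
  -- The weight vanishes at `m = 0`, so the negative term lies elsewhere.
  · rw [Nat.pos_iff_ne_zero]
    rintro rfl
    simp at hlt
  · by_contra h0
    have := mul_nonneg (not_lt.1 h0)
      (sub_nonneg.2 (Real.cos_le_one (2 * Real.pi * m / ((L + R + 2 : ℕ) : ℝ))))
    exact absurd hlt (not_lt.2 this)

/-! ### Roots, eigenvalues and instability. -/

lemma exists_root_re_neg {b c : ℂ} (hb : b.re < 0) : ∃ z : ℂ, z.re < 0 ∧ z ^ 2 - b * z - c = 0 := by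
  obtain ⟨s, hs⟩ := IsAlgClosed.exists_pow_nat_eq (b ^ 2 + 4 * c) two_pos
  rcases le_total s.re 0 with h | h
  · refine ⟨(b + s) / 2, ?_, by linear_combination hs / 4⟩
    rw [Complex.div_ofNat_re, Complex.add_re]
    linarith
  · refine ⟨(b - s) / 2, ?_, by linear_combination hs / 4⟩
    rw [Complex.div_ofNat_re, Complex.sub_re]
    linarith

/-- The roots of the characteristic equation at the `N`-th roots of unity give eigenvalues of the
semi-discrete system on `N` cells. -/
lemma hasEigenvalue_semiDiscrete (D : DDO L R) {N : ℕ} (hN : 0 < N) (m : ℕ) (h : ℝ) {z : ℂ}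
    (hz0 : z ≠ 0)
    (hz : z ^ 2 - D.H (2 * Real.pi * m / N) * z - D.F (2 * Real.pi * m / N) = 0) :
    (D.semiDiscrete N h).HasEigenvalue (-((1 / (h : ℂ)) * z)) := by
  have : NeZero N := ⟨hN.ne'⟩
  set θ : ℝ := 2 * Real.pi * m / N with hθ
  let e : ZMod N → ℂ := fun j => ZMod.stdAddChar ((m : ZMod N) * j)
  have he : ∀ (j : ZMod N) (k : ℤ), e (j + (k : ZMod N)) = e j * Complex.exp (Complex.I * k * θ) := by
    intro j k
    change ZMod.stdAddChar _ = ZMod.stdAddChar _ * _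
    rw [mul_add, AddChar.map_add_eq_mul]
    congr 1
    have : (m : ZMod N) * (k : ZMod N) = ((m * k : ℤ) : ZMod N) := by push_cast; ring
    rw [this, ZMod.stdAddChar_coe, hθ]
    congr 1
    push_cast
    ring
  have he1 : ∀ j : ZMod N, e (j + 1) = e j * Complex.exp (Complex.I * θ) := by
    intro j
    simpa using he j 1
  -- With these amplitudes the cell equation holds identically, and the node equation is the
  -- characteristic equation. The nodal amplitude `z ≠ 0` keeps the vector nonzero even if `e^{iθ} =
  -- 1`.
  let w : (ZMod N → ℂ) × (ZMod N → ℂ) :=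
    (fun j => (Complex.exp (Complex.I * θ) - 1) * e j, fun j => z * e j)
  have hw : w ≠ 0 := by
    intro h0
    have h1 := congrFun (congrArg Prod.snd h0) 0
    have h2 : z * ZMod.stdAddChar ((m : ZMod N) * 0) = 0 := h1
    rw [mul_zero, AddChar.map_zero_eq_one, mul_one] at h2
    exact hz0 h2
  refine Module.End.hasEigenvalue_of_hasEigenvector (x := w)
    ⟨Module.End.mem_eigenspace_iff.2 (Prod.ext (funext fun j => ?_) (funext fun j => ?_)), hw⟩
  · change -((1 / (h : ℂ)) * (z * e (j + 1) - z * e j))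
      = -((1 / (h : ℂ)) * z) * ((Complex.exp (Complex.I * θ) - 1) * e j)
    rw [he1]
    ring
  · change -((1 / (h : ℂ)) * ∑ k ∈ cells L R, (D.α k : ℂ)
          * ((Complex.exp (Complex.I * θ) - 1) * e (j + (k : ZMod N)))
        + (1 / (h : ℂ)) * ∑ k ∈ nodes L R, (D.β k : ℂ) * (z * e (j + (k : ZMod N))))
      = -((1 / (h : ℂ)) * z) * (z * e j)
    have s1 : ∑ k ∈ cells L R, (D.α k : ℂ)
          * ((Complex.exp (Complex.I * θ) - 1) * e (j + (k : ZMod N))) = D.F θ * e j := by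
      rw [F, G, Finset.mul_sum, Finset.sum_mul]
      refine Finset.sum_congr rfl fun k _ => ?_
      rw [he]
      ring
    have s2 : ∑ k ∈ nodes L R, (D.β k : ℂ) * (z * e (j + (k : ZMod N))) = D.H θ * z * e j := by
      rw [H, Finset.sum_mul, Finset.sum_mul]
      refine Finset.sum_congr rfl fun k _ => ?_
      rw [he]
      ring
    rw [s1, s2]
    linear_combination (1 / (h : ℂ)) * e j * hz

lemma not_isStable_of_re_H_neg (D : DDO L R) {N m : ℕ} (hm : m < N)
    (h : (D.H (2 * Real.pi * m / N)).re < 0) : ¬ D.IsStable := by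
  intro hs
  obtain ⟨z, hz, hroot⟩ := exists_root_re_neg (c := D.F (2 * Real.pi * m / N)) h
  have hz0 : z ≠ 0 := by
    rintro rfl
    simp at hz
  have hN : 0 < N := by omega
  have he := D.hasEigenvalue_semiDiscrete hN m 1 hz0 hroot
  rcases (hs N hN 1 one_pos).1 _ he with h1 | h1
  · simp at h1
    linarith
  · simp at h1
    exact hz0 h1

end DDO

end HV

theorem theorem1 (L R : ℕ) (D : HV.DDO L R) (hD : D.IsOptimal) :
    ((∀ θ : ℝ, 0 < θ → θ ≤ Real.pi → 0 < (D.H θ).re) →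
      (L : ℝ) - (R : ℝ) < min (2 * (R : ℝ) + 7) (9 + Real.sqrt (21 * (R : ℝ) + 49))) ∧
    (min (2 * (R : ℝ) + 7) (9 + Real.sqrt (21 * (R : ℝ) + 49)) ≤ (L : ℝ) - (R : ℝ) →
      ¬ D.IsStable ∧ ¬ D.rootSet ⊆ {z : ℂ | 0 < z.re}) := by
  have key : min (2 * (R : ℝ) + 7) (9 + Real.sqrt (21 * (R : ℝ) + 49)) ≤ (L : ℝ) - (R : ℝ) →
      ∃ N m : ℕ, 0 < m ∧ m < N ∧ (D.H (2 * Real.pi * m / N)).re < 0 := by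
    intro h
    refine HV.DDO.exists_re_H_neg hD ?_ (HV.defect_pos h)
    -- This forces `L ≥ 7`, so the node `-1` belongs to the stencil.
    have h7 : (7 : ℝ) ≤ min (2 * (R : ℝ) + 7) (9 + Real.sqrt (21 * (R : ℝ) + 49)) := by
      have h1 := Real.sqrt_nonneg (21 * (R : ℝ) + 49)
      have h2 : (0 : ℝ) ≤ R := R.cast_nonneg
      exact le_min (by linarith) (by linarith)
    have hL : (7 : ℝ) ≤ L := by
      have h2 : (0 : ℝ) ≤ R := R.cast_nonneg
      linarith
    have hL' : 7 ≤ L := by exact_mod_cast hL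
    unfold HV.numNodes
    omega
  have angle : ∀ N m : ℕ, 0 < m → m < N →
      0 < 2 * Real.pi * m / N ∧ 2 * Real.pi * m / N < 2 * Real.pi := by
    intro N m hm hmN
    have hm' : (0 : ℝ) < m := by exact_mod_cast hm
    have hmN' : (m : ℝ) < N := by exact_mod_cast hmN
    have hN : (0 : ℝ) < N := hm'.trans hmN'
    have hpi := Real.pi_pos
    refine ⟨by positivity, ?_⟩
    rw [div_lt_iff₀ hN]
    exact mul_lt_mul_of_pos_left hmN' (by positivity)
  constructor
  · intro hpos
    by_contra hlt
    obtain ⟨N, m, hm, hmN, hneg⟩ := key (not_lt.1 hlt)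
    obtain ⟨h1, h2⟩ := angle N m hm hmN
    rcases le_total (2 * Real.pi * m / N) Real.pi with h | h
    · exact absurd hneg (hpos _ h1 h).not_gt
    -- `Re H` is symmetric about `π`, so angles beyond `π` reflect into the range of the hypothesis.
    · have := hpos (2 * Real.pi - 2 * Real.pi * m / N) (by linarith) (by linarith)
      rw [D.re_H_two_pi_sub] at this
      exact absurd hneg this.not_gt
  · intro h
    obtain ⟨N, m, hm, hmN, hneg⟩ := key h
    refine ⟨D.not_isStable_of_re_H_neg hmN hneg, fun hsub => ?_⟩
    obtain ⟨h1, h2⟩ := angle N m hm hmN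
    obtain ⟨z, hz, hroot⟩ := HV.DDO.exists_root_re_neg (c := D.F (2 * Real.pi * m / N)) hneg
    exact absurd hz (not_lt.2 (le_of_lt (hsub ⟨_, h1, h2, hroot⟩)))
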